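/- Let $V$ be a finite set of points in the Euclidean plane, and fix an orthonormal coordinate system. For each $u\in V$ the four axis-parallel rays from $u$ bound four quadrants (cones) at $u$, taken half-open, so that they partition the plane minus $u$: $\{x>0,\,y\ge 0\}$, $\{x\le 0,\,y>0\}$, $\{x<0,\,y\le 0\}$, $\{x\ge 0,\,y<0\}$ in coordinates centred at $u$. The Yao graph $Y_4$ on $V$ is obtained by picking, for each $u\in V$ and each cone at $u$ that contains a point of $V$, a shortest edge $uv$ (in the Euclidean metric) with $v\in V$ in that cone, ties being broken arbitrarily; the edges picked, regarded as undirected, are the edges of $Y_4$. Then for every real $t\ge 8(29+23\sqrt2)$, and for every way of breaking the ties, $Y_4$ is a $t$-spanner: for any two points $u,v\in V$ there is a path in $Y_4$ from $u$ to $v$ whose total Euclidean length is at most $t\,|uv|$. -/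

import Mathlib

/-- The Euclidean plane. -/
abbrev Plane : Type := EuclideanSpace ℝ (Fin 2)

/-- The `i`-th half-open quadrant (cone) at `u`, with respect to the coordinate axes given by the
orthonormal basis `b`. The four axis rays at `u` bound the four cones; each cone contains
exactly one of its two bounding rays, always the first one in the order in which the rays
are met when turning from the first basis vector towards the second. Hence the four cones at `u`
partition the plane minus `u`. -/
def InQuadrant (b : OrthonormalBasis (Fin 2) ℝ Plane) (i : Fin 4) (u v : Plane) : Prop :=
  match i with
  | 0 => 0 < b.repr (v - u) 0 ∧ 0 ≤ b.repr (v - u) 1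
  | 1 => b.repr (v - u) 0 ≤ 0 ∧ 0 < b.repr (v - u) 1
  | 2 => b.repr (v - u) 0 < 0 ∧ b.repr (v - u) 1 ≤ 0
  | 3 => 0 ≤ b.repr (v - u) 0 ∧ b.repr (v - u) 1 < 0

/-- `v` is a nearest node of `V` (in the Euclidean metric) to `u` among the nodes of `V`
in the `i`-th cone at `u`; i.e. `uv` is a shortest edge in that cone. -/
def IsShortestInCone (b : OrthonormalBasis (Fin 2) ℝ Plane) (V : Finset Plane) (i : Fin 4)
    (u v : V) : Prop :=
  InQuadrant b i u v ∧ ∀ w : V, InQuadrant b i u w → dist u v ≤ dist u w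

/-- `E` is a set of directed edges obtained by the Yao construction with four cones on `V`:
at each node, in each cone containing a node, one shortest edge is picked (ties being broken
in an arbitrary way), and there are no other edges. -/
structure IsYaoFour (b : OrthonormalBasis (Fin 2) ℝ Plane) (V : Finset Plane)
    (E : V → V → Prop) : Prop where
  shortest : ∀ u v : V, E u v → ∃ i : Fin 4, IsShortestInCone b V i u v
  pick : ∀ (u : V) (i : Fin 4), (∃ w : V, InQuadrant b i u w) →
    ∃! v : V, InQuadrant b i u v ∧ E u v

/-- The undirected graph underlying a directed edge set. -/
def undirected {V : Finset Plane} (E : V → V → Prop) : SimpleGraph V :=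
  SimpleGraph.fromRel E

/-- The Euclidean length of a walk, the sum of the lengths of its edges. -/
noncomputable def walkLength {V : Finset Plane} {H : SimpleGraph V} {u v : V}
    (p : H.Walk u v) : ℝ :=
  (p.darts.map fun d => dist d.fst d.snd).sum

/-- `H` is a `t`-spanner of the complete Euclidean graph on `V`: any two nodes are joined by a path
of `H` of length at most `t` times their distance. -/
def IsSpanner {V : Finset Plane} (H : SimpleGraph V) (t : ℝ) : Prop :=
  ∀ u v : V, ∃ p : H.Walk u v, p.IsPath ∧ walkLength p ≤ t * dist u v

/-! A slight rotation puts the points in general position and turns half-open quadrants into open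
ones. Path cost is then compared with the norm `nearMax`, max plus a twentieth of min: `le_nearMax`
bounds the cost between any two points by 490 times their `nearMax` distance.

Take a counterexample `a`, `t` with least distance. If `u` is reached from `a` and `v` from `t` at
total cost `c`, then `u` and `v` cannot be closer than `a` and `t` by more than `c / 490`, since
otherwise minimality would supply the middle of a path from `a` to `t`. So cheap detours make almost
no progress (`far`). With `t` at the origin and `a` on `ξ = 1`, cheaply reached points of moderate
height therefore hug the line `ξ = 1`, and steps towards `t` must jump across the axis `η = 0`.

Such crossing steps (tails) yield tails with ever higher heads on alternating sides of the axis
(`exists_longer_tail`), until one has nearly unit height (`exists_isLongTail`). The same happens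
from `t`. The two long tails lead to points reached from opposite ends that are too close to each
other (`TwoSided.elim`). -/

theorem le_add_of_sq_le_sq_add_sq {a b c : ℝ} (hb : 0 ≤ b) (hc : 0 ≤ c)
    (h : a ^ 2 ≤ b ^ 2 + c ^ 2) : a ≤ b + c := by
  nlinarith [mul_nonneg hb hc]

/-! ### Yao edges in coordinates in general position -/

/-- Points with coordinates `x`, `y` in general position, and an edge relation which, at every
point and for each of the four open quadrants there, contains an edge to a nearest point of the
quadrant, if there is one. -/
structure IsYaoCoords {V : Type*} (Adj : V → V → Prop) (x y : V → ℝ) : Prop where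
  injx : Function.Injective x
  injy : Function.Injective y
  nearest : ∀ s r : ℝ, (s = 1 ∨ s = -1) → (r = 1 ∨ r = -1) → ∀ u v : V,
    0 < s * (x v - x u) → 0 < r * (y v - y u) → ∃ w, Adj u w ∧
      0 < s * (x w - x u) ∧ 0 < r * (y w - y u) ∧
      ∀ z, 0 < s * (x z - x u) → 0 < r * (y z - y u) →
        (x w - x u) ^ 2 + (y w - y u) ^ 2 ≤ (x z - x u) ^ 2 + (y z - y u) ^ 2

/-- `w` is a neighbour of `u` which is nearest to `u` among the points with smaller first and
larger second coordinate. -/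
structure IsStep {V : Type*} (Adj : V → V → Prop) (x y : V → ℝ) (u w : V) : Prop where
  adj : Adj u w
  lt_x : x w < x u
  lt_y : y u < y w
  le : ∀ z, x z < x u → y u < y z →
    (x u - x w) ^ 2 + (y w - y u) ^ 2 ≤ (x u - x z) ^ 2 + (y z - y u) ^ 2

section Coords

variable {V : Type*} {Adj : V → V → Prop} {x y : V → ℝ}

theorem IsYaoCoords.affine (h : IsYaoCoords Adj x y) {e f : ℝ} (he : e = 1 ∨ e = -1)
    (hf : f = 1 ∨ f = -1) {c : ℝ} (hc : 0 < c) (p q : ℝ) :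
    IsYaoCoords Adj (fun v => c * (e * x v) + p) (fun v => c * (f * y v) + q) := by
  have he0 : e ≠ 0 := by rcases he with rfl | rfl <;> norm_num
  have hf0 : f ≠ 0 := by rcases hf with rfl | rfl <;> norm_num
  have he2 : e ^ 2 = 1 := by rcases he with rfl | rfl <;> norm_num
  have hf2 : f ^ 2 = 1 := by rcases hf with rfl | rfl <;> norm_num
  refine ⟨fun u v huv => h.injx ?_, fun u v huv => h.injy ?_, ?_⟩
  · have : c * e * (x u - x v) = 0 := by linarith
    rcases mul_eq_zero.1 this with h1 | h1
    · exact absurd h1 (mul_ne_zero hc.ne' he0)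
    · linarith
  · have : c * f * (y u - y v) = 0 := by linarith
    rcases mul_eq_zero.1 this with h1 | h1
    · exact absurd h1 (mul_ne_zero hc.ne' hf0)
    · linarith
  · intro s r hs hr u v hx hy
    have key : ∀ (s e : ℝ) (X Y : ℝ),
        s * ((c * (e * X) + p) - (c * (e * Y) + p)) = c * ((s * e) * (X - Y)) := by
      intros; ring
    have key' : ∀ (s e : ℝ) (X Y : ℝ),
        s * ((c * (e * X) + q) - (c * (e * Y) + q)) = c * ((s * e) * (X - Y)) := by
      intros; ring
    have hse : s * e = 1 ∨ s * e = -1 := by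
      rcases hs with rfl | rfl <;> rcases he with rfl | rfl <;> norm_num
    have hrf : r * f = 1 ∨ r * f = -1 := by
      rcases hr with rfl | rfl <;> rcases hf with rfl | rfl <;> norm_num
    simp only [key, key', mul_pos_iff_of_pos_left hc] at hx hy ⊢
    obtain ⟨w, hw, hwx, hwy, hmin⟩ := h.nearest _ _ hse hrf u v hx hy
    refine ⟨w, hw, hwx, hwy, fun z hzx hzy => ?_⟩
    have h3 := hmin z hzx hzy
    have e1 : ∀ X Y : ℝ, (c * (e * X) + p - (c * (e * Y) + p)) ^ 2 = c ^ 2 * (X - Y) ^ 2 := by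
      intro X Y; linear_combination c ^ 2 * (X - Y) ^ 2 * he2
    have e2 : ∀ X Y : ℝ, (c * (f * X) + q - (c * (f * Y) + q)) ^ 2 = c ^ 2 * (X - Y) ^ 2 := by
      intro X Y; linear_combination c ^ 2 * (X - Y) ^ 2 * hf2
    rw [e1, e2, e1, e2, ← mul_add, ← mul_add]
    exact mul_le_mul_of_nonneg_left h3 (sq_nonneg c)

theorem IsYaoCoords.swap (h : IsYaoCoords Adj x y) : IsYaoCoords Adj y x := by
  refine ⟨h.injy, h.injx, fun s r hs hr u v hx hy => ?_⟩
  obtain ⟨w, hw, hwx, hwy, hmin⟩ := h.nearest r s hr hs u v hy hx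
  exact ⟨w, hw, hwy, hwx, fun z hzx hzy => by linarith [hmin z hzy hzx]⟩

theorem IsYaoCoords.neg_right (h : IsYaoCoords Adj x y) :
    IsYaoCoords Adj x (fun v => -y v) := by
  simpa using h.affine (Or.inl rfl) (Or.inr rfl) one_pos 0 0

theorem IsYaoCoords.exists_isStep (h : IsYaoCoords Adj x y) {u v : V} (hx : x v < x u)
    (hy : y u < y v) : ∃ w, IsStep Adj x y u w := by
  obtain ⟨w, hw, hwx, hwy, hmin⟩ := h.nearest (-1) 1 (Or.inr rfl) (Or.inl rfl) u v
    (by linarith) (by linarith)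
  refine ⟨w, hw, by linarith, by linarith, fun z hzx hzy => ?_⟩
  have := hmin z (by linarith) (by linarith)
  nlinarith

end Coords

/-! ### One-sided approach: tails and how they grow -/

/-- Coordinates in which the target `t` is the origin, the source `a` lies on the line `ξ = 1` in
the sector `|η| ≤ ξ`, together with a notion of points that are reachable from `a` at a
given cost; no reachable point is closer to the target, in the norm
`max |ξ| |η| + min |ξ| |η| / 20`, by a definite proportion of the cost of reaching it. -/
structure Approach {V : Type*} (Adj : V → V → Prop) (ξ η : V → ℝ) (Reach : V → ℝ → Prop)
    (a t : V) : Prop where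
  coords : IsYaoCoords Adj ξ η
  tξ : ξ t = 0
  tη : η t = 0
  aξ : ξ a = 1
  aη : |η a| ≤ 1
  start : Reach a 0
  mono : ∀ u c c', Reach u c → c ≤ c' → Reach u c'
  step : ∀ u w c, Reach u c → Adj u w → Reach w (c + |ξ w - ξ u| + |η w - η u|)
  far : ∀ u c, Reach u c → 1 + |η a| / 20 - c / 490 ≤ |ξ u| + |η u| / 20 ∨
    1 + |η a| / 20 - c / 490 ≤ |η u| + |ξ u| / 20

/-- The step from the point `p` below the axis `η = 0` crosses the axis. -/
structure IsTail {V : Type*} (Adj : V → V → Prop) (ξ η : V → ℝ) (p g : V) : Prop where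
  step : IsStep Adj ξ η p g
  η_neg : η p < 0
  ξ_pos : 0 < ξ g
  η_pos : 0 < η g

namespace Approach

variable {V : Type*} {Adj : V → V → Prop} {ξ η : V → ℝ} {Reach : V → ℝ → Prop} {a t : V}

theorem reflect (h : Approach Adj ξ η Reach a t) :
    Approach Adj ξ (fun v => -η v) Reach a t := by
  refine ⟨h.coords.neg_right, h.tξ, by simp [h.tη], h.aξ, by simpa using h.aη, h.start, h.mono,
    fun u w c hu hw => ?_, fun u c hu => ?_⟩
  · have : |-η w - -η u| = |η w - η u| := by rw [← abs_neg]; congr 1; ring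
    rw [this]; exact h.step u w c hu hw
  · simpa using h.far u c hu

theorem reach_of_isStep (h : Approach Adj ξ η Reach a t) {u w : V} {c : ℝ} (hu : Reach u c)
    (hw : IsStep Adj ξ η u w) : Reach w (c + (ξ u - ξ w) + (η w - η u)) := by
  have := h.step u w c hu hw.adj
  rwa [abs_of_neg (by linarith [hw.lt_x]), abs_of_pos (by linarith [hw.lt_y]), neg_sub] at this

theorem far_l1 (h : Approach Adj ξ η Reach a t) {u : V} {c : ℝ} (hu : Reach u c) :
    1 - c / 490 ≤ |ξ u| + |η u| := by
  have := abs_nonneg (η a)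
  have := abs_nonneg (ξ u)
  have := abs_nonneg (η u)
  rcases h.far u c hu with h1 | h1 <;> linarith

/-- The second alternative of `far` is impossible here, as `17/20 + 1/20 < 1 - 40/490`. This is the
rigidity that pins cheaply reached points to the line `ξ = 1`. -/
theorem far_ξ (h : Approach Adj ξ η Reach a t) {u : V} {c : ℝ} (hu : Reach u c) (hc : c ≤ 40)
    (h0 : 0 ≤ ξ u) (h1 : ξ u ≤ 1) (h2 : |η u| ≤ 17 / 20) :
    1 - ξ u ≤ |η u| / 20 + c / 490 := by
  have := abs_nonneg (η a)
  rcases h.far u c hu with h3 | h3 <;> rw [abs_of_nonneg h0] at h3 <;> linarith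

/-- Steps are repeated while they stay in the open quadrant; `t` always provides a next one. The
chain is monotone in both coordinates, so its cost is just the `ℓ¹` displacement. -/
theorem chain_up [Finite V] (h : Approach Adj ξ η Reach a t) {s : V} {c : ℝ} (h1 : 0 < ξ s)
    (h2 : η s < 0) (hs : Reach s c) : ∃ s' g, ξ s' ≤ ξ s ∧ η s ≤ η s' ∧ η s' < 0 ∧ 0 < ξ s' ∧
      IsStep Adj ξ η s' g ∧ Reach s' (c + (ξ s - ξ s') + (η s' - η s)) ∧
      ¬ (0 < ξ g ∧ η g < 0) := by
  classical
  have := Fintype.ofFinite V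
  let S : Finset V := Finset.univ.filter fun v => ξ v ≤ ξ s ∧ η s ≤ η v ∧ η v < 0 ∧ 0 < ξ v ∧
    Reach v (c + (ξ s - ξ v) + (η v - η s))
  have hsS : s ∈ S := by simp [S, h1, h2, hs]
  obtain ⟨s', hs', hmax⟩ := S.exists_max_image (fun v => η v - ξ v) ⟨s, hsS⟩
  simp only [S, Finset.mem_filter, Finset.mem_univ, true_and] at hs' hmax
  obtain ⟨g1, g2, g3, g4, g5⟩ := hs'
  obtain ⟨g, hg⟩ := h.coords.exists_isStep (u := s') (v := t) (by rw [h.tξ]; exact g4)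
    (by rw [h.tη]; exact g3)
  refine ⟨s', g, g1, g2, g3, g4, hg, g5, fun ⟨k1, k2⟩ => ?_⟩
  have := hmax g ⟨by linarith [hg.lt_x], by linarith [hg.lt_y], k2, k1,
    h.mono _ _ _ (h.reach_of_isStep g5 hg) (by linarith)⟩
  linarith [hg.lt_x, hg.lt_y]

/-- An exit to `ξ ≤ 0` would land in the disc about `s` through `t`, hence not above the axis and at
most `9/20` beyond `t`, which `far` forbids. -/
theorem isTail_of_exit (h : Approach Adj ξ η Reach a t) {s g : V} {c : ℝ} (h0 : 0 < ξ s)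
    (h1 : ξ s ≤ 1) (h2 : η s < 0) (h3 : -(17 / 20) ≤ η s) (hs : Reach s c) (hc : c ≤ 25)
    (hg : IsStep Adj ξ η s g) (hb : ¬ (0 < ξ g ∧ η g < 0)) : IsTail Adj ξ η s g := by
  have hD := h.far_ξ hs (by linarith) h0.le h1 (by rw [abs_of_neg h2]; linarith)
  rw [abs_of_neg h2] at hD
  have hr := h.reach_of_isStep hs hg
  have hle := hg.le t (by rw [h.tξ]; exact h0) (by rw [h.tη]; exact h2)
  rw [h.tξ, h.tη] at hle
  have l1 := hg.lt_x
  have l2 := hg.lt_y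
  by_cases hξ : 0 < ξ g
  · refine ⟨hg, h2, hξ, lt_of_le_of_ne (not_lt.1 fun h' => hb ⟨hξ, h'⟩) fun h' => ?_⟩
    have : g = t := h.coords.injy (by rw [h.tη, ← h'])
    rw [this, h.tξ] at hξ
    exact lt_irrefl _ hξ
  · exfalso
    push Not at hξ
    have k1 : (-ξ g) ^ 2 + 2 * ξ s * (-ξ g) + (η g - η s) ^ 2 ≤ (η s) ^ 2 := by nlinarith
    have k2 : η g ≤ 0 := by nlinarith
    have k3 : -ξ g ≤ 9 / 20 := by nlinarith
    rcases h.far _ _ hr with h4 | h4 <;>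
      rw [abs_of_nonpos hξ, abs_of_nonpos k2] at h4 <;> linarith [abs_nonneg (η a)]

end Approach

namespace Approach

variable {V : Type*} {Adj : V → V → Prop} {ξ η : V → ℝ} {Reach : V → ℝ → Prop} {a t : V}

/-- Points in the step quadrant of a tail that lie below the tail's head are not below a
definite distance from the tail. -/
theorem _root_.IsTail.le_add {p g z : V} (hp : IsTail Adj ξ η p g) (hx : ξ z < ξ p)
    (hy : η p < η z) : η g ≤ (ξ p - ξ z) + η z := by
  have h1 := hp.step.le z hx hy
  have h2 : (η g - η p) ^ 2 ≤ (ξ p - ξ z) ^ 2 + (η z - η p) ^ 2 := by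
    nlinarith [sq_nonneg (ξ p - ξ g)]
  linarith [le_add_of_sq_le_sq_add_sq (by linarith) (by linarith) h2]

/-- If `z` were in the step quadrant of `p`, then `IsTail.le_add` and `far_l1` would bound `η g` by
the cost of reaching `z` over 490, too little for the assumed height of `g`. -/
theorem not_mem_quadrant_of_isTail (h : Approach Adj ξ η Reach a t) {p g z : V} {c y : ℝ}
    (hp : IsTail Adj ξ η p g) (hp1 : ξ p ≤ 1) (hz : Reach z (c + (ξ p - ξ z)))
    (hc : c ≤ 350 * y) (hg : 17 / 20 * y ≤ η g) (hm : -η z ≤ 11 / 5 * y)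
    (hx : ξ z < ξ p) (hz0 : 0 < ξ z) (hz1 : η z < 0) : η z ≤ η p := by
  by_contra! hcon
  have h1 := hp.le_add hx hcon
  have h2 := h.far_l1 hz
  rw [abs_of_pos hz0, abs_of_neg hz1] at h2
  linarith

/-- A point in the lower left corner of `p` allows a step down to some `q`, followed by a chain up.
The chain cannot enter the step quadrant of `p`, so it ends in a tail further left and lower. -/
theorem exists_sweep [Finite V] (h : Approach Adj ξ η Reach a t) {p g z : V} {c y L : ℝ}
    (hp : IsTail Adj ξ η p g) (hp0 : 0 < ξ p) (hp1 : ξ p ≤ 1) (hr : Reach p c)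
    (hy1 : y ≤ 1) (hc : c ≤ 12 * y) (hg : 17 / 20 * y ≤ η g) (hL : L ≤ 17 / 20)
    (hLy : L ≤ 11 / 5 * y) (hpL : -η p < L) (hzx : ξ z < ξ p) (hzy : η z < η p)
    (hz : (ξ p - ξ z) ^ 2 + (η p - η z) ^ 2 < (L + η p) ^ 2) :
    ∃ p' g', IsTail Adj ξ η p' g' ∧ 0 < ξ p' ∧ ξ p' < ξ p ∧ η p' < η p ∧ -L ≤ η p' ∧
      Reach p' (c + 3 * (ξ p - ξ p') + (η p - η p')) := by
  have hpn := hp.η_neg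
  obtain ⟨q, hq⟩ := h.reflect.coords.exists_isStep (u := p) (v := z) hzx (by simpa using hzy)
  have hqr := h.reflect.reach_of_isStep hr hq
  have hqx := hq.lt_x
  have hqy := hq.lt_y
  have hqz := hq.le z hzx (by simpa using hzy)
  have hmin := hq.le
  simp only [neg_lt_neg_iff, neg_sub_neg] at hqr hqy hqz hmin
  have hd : (ξ p - ξ q) ^ 2 + (η p - η q) ^ 2 < (L + η p) ^ 2 := by linarith
  have hqL : η p - η q < L + η p := by nlinarith [sq_nonneg (ξ p - ξ q)]
  have hqL' : ξ p - ξ q < L + η p := by nlinarith [sq_nonneg (η p - η q)]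
  have hD := h.far_ξ hr (by linarith) hp0.le hp1 (by rw [abs_of_neg hpn]; linarith)
  rw [abs_of_neg hpn] at hD
  obtain ⟨p', g', k1, k2, k3, k4, k5, k6, k7⟩ := h.chain_up (s := q) (by linarith)
    (by linarith) hqr
  have k8 : η p' ≤ η p := by
    refine h.not_mem_quadrant_of_isTail (c := c + 2 * (η p - η q) + (η p' - η p)) (y := y) hp hp1
      (h.mono _ _ _ k6 (by linarith)) (by linarith) hg (by linarith) (by linarith)
      k4 k3
  have k9 : η p' < η p := lt_of_le_of_ne k8 fun h' => by
    have := h.coords.injy h'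
    subst this
    linarith
  have hx' : ξ p' < ξ p := by linarith
  have k10 := hmin p' hx' k9
  -- `p'` lies in the quadrant where `q` is nearest to `p`. This bounds the detour below `p'` and
  -- produces the coefficients 3 and 1 of the cost.
  have k11 : η p - η q ≤ (ξ p - ξ p') + (η p - η p') :=
    le_add_of_sq_le_sq_add_sq (by linarith) (by linarith)
      (by nlinarith [sq_nonneg (ξ p - ξ q)])
  have hr' : Reach p' (c + 3 * (ξ p - ξ p') + (η p - η p')) :=
    h.mono _ _ _ k6 (by linarith)
  refine ⟨p', g', ?_, k4, hx', k9, by linarith, hr'⟩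
  refine h.isTail_of_exit k4 (by linarith) k3 (by linarith)
    (h.mono _ _ (c + (ξ p - ξ p') + 2 * (η p - η q)) k6 (by linarith)) ?_ k5 k7
  linarith

/-- At the leftmost tail reached by sweeps no further sweep is possible, so its lower left corner is
empty up to `L`. Rigidity in `ξ` keeps the total cost of sweeping proportional to `η g₀`. -/
theorem exists_outermost_tail [Finite V] (h : Approach Adj ξ η Reach a t) {p₀ g₀ : V} {L : ℝ}
    (hp : IsTail Adj ξ η p₀ g₀) (hp0 : 0 < ξ p₀) (hp1 : ξ p₀ ≤ 1)
    (hr : Reach p₀ (46 / 5 * η g₀)) (hy1 : η g₀ ≤ 1) (hm : -η p₀ ≤ 11 / 5 * η g₀)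
    (hm' : -η p₀ ≤ 17 / 20) (hL : L ≤ 17 / 20) (hLy : L ≤ 11 / 5 * η g₀) :
    ∃ p g, IsTail Adj ξ η p g ∧ 0 < ξ p ∧ ξ p ≤ ξ p₀ ∧ η p ≤ η p₀ ∧ -η p ≤ 11 / 5 * η g₀ ∧
      -η p ≤ 17 / 20 ∧
      Reach p (46 / 5 * η g₀ + 3 * (ξ p₀ - ξ p) + (η p₀ - η p)) ∧
      3 * (ξ p₀ - ξ p) + (η p₀ - η p) ≤ 27 / 10 * η g₀ ∧
      (17 / 20 < η g ∨ 9 / 10 * η g₀ ≤ η g) ∧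
      ∀ z, ξ z < ξ p → η z < η p → L ≤ ξ p - ξ z - η z := by
  classical
  have := Fintype.ofFinite V
  have hy0 := hp.η_pos
  have hpn := hp.η_neg
  let S : Finset V := Finset.univ.filter fun p => (∃ g, IsTail Adj ξ η p g) ∧ 0 < ξ p ∧
    ξ p ≤ ξ p₀ ∧ η p ≤ η p₀ ∧ (p = p₀ ∨ -L ≤ η p) ∧
    Reach p (46 / 5 * η g₀ + 3 * (ξ p₀ - ξ p) + (η p₀ - η p))
  have hsS : p₀ ∈ S := by
    simp only [S, Finset.mem_filter, Finset.mem_univ, true_and]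
    exact ⟨⟨g₀, hp⟩, hp0, le_rfl, le_rfl, Or.inl trivial, by simpa using hr⟩
  obtain ⟨p, hpS, hmax⟩ := S.exists_max_image (fun v => -ξ v) ⟨p₀, hsS⟩
  simp only [S, Finset.mem_filter, Finset.mem_univ, true_and] at hpS hmax
  obtain ⟨⟨g, hg⟩, a1, a2, a3, a4, a5⟩ := hpS
  have hpn' := hg.η_neg
  have a6 : -η p ≤ 11 / 5 * η g₀ := by
    rcases a4 with rfl | a4 <;> linarith
  have a7 : -η p ≤ 17 / 20 := by
    rcases a4 with rfl | a4 <;> linarith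
  have a8 : 3 * (ξ p₀ - ξ p) + (η p₀ - η p) ≤ 27 / 10 * η g₀ := by
    by_contra! hcon
    have hD := h.far_ξ (h.mono _ _ (46 / 5 * η g₀ + 3 * (1 - ξ p) + (-η p)) a5 (by linarith))
      (by linarith) a1.le (by linarith) (by rw [abs_of_neg hpn']; linarith)
    rw [abs_of_neg hpn'] at hD
    linarith
  have a9 : 17 / 20 < η g ∨ 9 / 10 * η g₀ ≤ η g := by
    refine or_iff_not_imp_left.2 fun h' => ?_
    push Not at h'
    have b1 := h.reach_of_isStep a5 hg.step
    have b0 := hg.η_pos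
    have b2 := hp.le_add (z := g) (by linarith [hg.step.lt_x]) (by linarith)
    have hD := h.far_ξ b1 (by linarith [hg.ξ_pos]) hg.ξ_pos.le (by linarith [hg.step.lt_x])
      (by rw [abs_of_pos b0]; exact h')
    rw [abs_of_pos b0] at hD
    linarith [hg.step.lt_x]
  refine ⟨p, g, hg, a1, a2, a3, a6, a7, a5, a8, a9, fun z hzx hzy => ?_⟩
  by_contra! hcon
  obtain ⟨p', g', c1, c2, c3, c4, c5, c6⟩ := h.exists_sweep (y := η g₀) (L := L) hg a1
    (by linarith) a5 hy1 (by linarith) (by rcases a9 with h9 | h9 <;> linarith) hL hLy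
    (by linarith) hzx hzy (by nlinarith)
  have := hmax p' ⟨⟨g', c1⟩, c2, by linarith, by linarith, Or.inr c5, h.mono _ _ _ c6 (by linarith)⟩
  linarith

end Approach

/-! ### Long tails -/

/-- A tail close to the axis, with a step of about unit length across the axis and no other points
nearby in its two quadrants facing the target. -/
structure IsLongTail {V : Type*} (Adj : V → V → Prop) (ξ η : V → ℝ) (Reach : V → ℝ → Prop)
    (p g : V) : Prop where
  tail : IsTail Adj ξ η p g
  ξ_pos : 0 < ξ p
  ξ_le : ξ p ≤ 1
  le_η : -η p ≤ 1634 / 10000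
  lt_η : 17 / 20 < η g
  reach : Reach p 12
  le : ∀ z, ξ z < ξ p → η z < η p → 17 / 20 ≤ ξ p - ξ z - η z

namespace Approach

variable {V : Type*} {Adj : V → V → Prop} {ξ η : V → ℝ} {Reach : V → ℝ → Prop} {a t : V}

theorem head_le_one (h : Approach Adj ξ η Reach a t) {p g : V} (hp : IsTail Adj ξ η p g)
    (hp0 : 0 < ξ p) (hp1 : ξ p ≤ 1) : (η g) ^ 2 - 2 * η g * η p < 1 := by
  have h1 := hp.step.le t (by rw [h.tξ]; exact hp0) (by rw [h.tη]; exact hp.η_neg)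
  rw [h.tξ, h.tη] at h1
  have h2 := hp.step.lt_x
  nlinarith

theorem head_lt_one (h : Approach Adj ξ η Reach a t) {p g : V} (hp : IsTail Adj ξ η p g)
    (hp0 : 0 < ξ p) (hp1 : ξ p ≤ 1) : η g < 1 := by
  have h1 := h.head_le_one hp hp0 hp1
  nlinarith [hp.η_pos, hp.η_neg, mul_pos hp.η_pos (neg_pos.2 hp.η_neg)]

/-- A chain down from the head `g` crosses the axis again at some `g'`. This point is not in the
step quadrant of `p`, so it lies in the lower left corner, whose emptiness up to `L` forces `g'` to
be deep. -/
theorem exists_opposite_tail [Finite V] (h : Approach Adj ξ η Reach a t) {p g : V} {c y L : ℝ}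
    (hp : IsTail Adj ξ η p g) (hp0 : 0 < ξ p) (hp1 : ξ p ≤ 1) (hr : Reach p c)
    (hc : c ≤ 119 / 10 * y) (hm : -η p ≤ 11 / 5 * y)
    (hg : 9 / 10 * y ≤ η g) (hg' : η g ≤ 17 / 20) (hg'' : η g ≤ 223 / 100 * y)
    (hL : L ≤ 17 / 20) (hz : ∀ z, ξ z < ξ p → η z < η p → L ≤ ξ p - ξ z - η z) :
    ∃ p' g', IsTail Adj ξ (fun v => -η v) p' g' ∧ 0 < ξ p' ∧ ξ p' ≤ ξ p ∧ η p' ≤ η g ∧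
      Reach p' (c + 2 * η g - η p - 3 / 5 * y) ∧ 4 / 5 * y ≤ η p' ∧
      L - 45 / 1000 * y ≤ -(1053 / 1000) * η g' := by
  have hgη := hp.η_pos
  have hpη := hp.η_neg
  have hgr := h.reach_of_isStep hr hp.step
  have hgx := hp.step.lt_x
  obtain ⟨p', g', k1, k2, k3, k4, k5, k6, k7⟩ :=
    h.reflect.chain_up (s := g) hp.ξ_pos (by linarith) hgr
  simp only [neg_le_neg_iff, neg_lt_zero] at k2 k3
  have hr1 : Reach p' (c + 2 * η g - η p + (ξ p - ξ p') - η p') :=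
    h.mono _ _ _ k6 (by linarith)
  have ht := h.reflect.isTail_of_exit k4 (by linarith) (by linarith) (by linarith)
    hr1 (by linarith) k5 k7
  have hD := h.far_ξ hr1 (by linarith) k4.le (by linarith) (by rw [abs_of_pos k3]; linarith)
  rw [abs_of_pos k3] at hD
  have hp'η := hp.le_add (z := p') (by linarith) (by linarith)
  have hlow : 4 / 5 * y ≤ η p' := by linarith
  have hr2 : Reach p' (c + 2 * η g - η p - 3 / 5 * y) := h.mono _ _ _ hr1 (by linarith)
  refine ⟨p', g', ht, k4, by linarith, k2, hr2, hlow, ?_⟩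
  have hx' := ht.step.lt_x
  have hy' := ht.η_pos
  have hξ' := ht.ξ_pos
  have hg'r := h.reflect.reach_of_isStep hr1 ht.step
  have hlt : η g' < η p := by
    refine lt_of_le_of_ne ?_ fun h' => ?_
    · by_contra! hcon
      exact absurd (h.not_mem_quadrant_of_isTail (c := c + 2 * η g - η p - η g') (y := y) hp hp1
        (h.mono _ _ _ hg'r (by linarith)) (by linarith) (by linarith) (by linarith)
        (by linarith) hξ' (by linarith)) (by linarith)
    · have := h.coords.injy h'
      subst this
      linarith
  have hLg := hz g' (by linarith) hlt
  by_cases hbig : -η g' ≤ 17 / 20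
  · have hD' := h.far_ξ hg'r (by linarith) hξ'.le (by linarith)
      (by rw [abs_of_neg (by linarith)]; linarith)
    rw [abs_of_neg (by linarith)] at hD'
    linarith
  · push Not at hbig
    linarith

/-- With `L = 11/5 * η g₀` the new head is about twice as far from the axis, so costs grow
geometrically and the invariant `46/5` times head height reproduces itself. -/
theorem exists_longer_tail [Finite V] (h : Approach Adj ξ η Reach a t) {p₀ g₀ : V}
    (hp : IsTail Adj ξ η p₀ g₀) (hp0 : 0 < ξ p₀) (hp1 : ξ p₀ ≤ 1)
    (hr : Reach p₀ (46 / 5 * η g₀)) (hm : -η p₀ ≤ 11 / 5 * η g₀) (hm' : -η p₀ ≤ 17 / 20)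
    (hy : η g₀ ≤ 17 / 44) :
    ∃ p g, (IsTail Adj ξ η p g ∨ IsTail Adj ξ (fun v => -η v) p g) ∧ 0 < ξ p ∧ ξ p ≤ 1 ∧
      Reach p (46 / 5 * |η g|) ∧ |η p| ≤ 11 / 5 * |η g| ∧ |η p| ≤ 17 / 20 ∧ η g₀ < |η g| := by
  have hy0 := hp.η_pos
  obtain ⟨p, g, a1, a2, a3, a4, a5, a6, a7, a8, a9, a10⟩ :=
    h.exists_outermost_tail (L := 11 / 5 * η g₀) hp hp0 hp1 hr (by linarith) hm hm'
      (by linarith) le_rfl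
  have hg0 := a1.η_pos
  have hpn := a1.η_neg
  by_cases hg : 2 * η g₀ ≤ η g
  · refine ⟨p, g, Or.inl a1, a2, by linarith, ?_⟩
    rw [abs_of_pos hg0, abs_of_neg hpn]
    exact ⟨h.mono _ _ _ a7 (by linarith), by linarith, by linarith, by linarith⟩
  · push Not at hg
    obtain ⟨p', g', b1, b2, b3, b4, b5, b6, b7⟩ := h.exists_opposite_tail (y := η g₀) a1 a2
      (by linarith) a7 (by linarith) a5
      (by rcases a9 with h9 | h9 <;> linarith) (by linarith) (by linarith) (by linarith) a10
    have hg' := b1.η_pos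
    refine ⟨p', g', Or.inr b1, b2, by linarith, ?_⟩
    rw [abs_of_neg (by linarith), abs_of_pos (by linarith)]
    exact ⟨h.mono _ _ _ b5 (by linarith), by linarith, by linarith, by linarith⟩

/-- Above `17/44` the empty corner can have the full size `17/20 = 11/5 * 17/44`. A short head would
then give an opposite tail too long for `head_le_one`, the target being nearer than its head. -/
theorem exists_isLongTail_of_tail [Finite V] (h : Approach Adj ξ η Reach a t) {p₀ g₀ : V}
    (hp : IsTail Adj ξ η p₀ g₀) (hp0 : 0 < ξ p₀) (hp1 : ξ p₀ ≤ 1)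
    (hr : Reach p₀ (46 / 5 * η g₀)) (hm : -η p₀ ≤ 11 / 5 * η g₀) (hm' : -η p₀ ≤ 17 / 20)
    (hy : 17 / 44 < η g₀) :
    -η p₀ ≤ 1634 / 10000 ∧ ∃ p g, IsLongTail Adj ξ η Reach p g := by
  have hy1 := h.head_lt_one hp hp0 hp1
  obtain ⟨p, g, a1, a2, a3, a4, a5, a6, a7, a8, a9, a10⟩ :=
    h.exists_outermost_tail (L := 17 / 20) hp hp0 hp1 hr (by linarith) hm hm'
      le_rfl (by linarith)
  have hg1 := h.head_le_one a1 a2 (by linarith)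
  by_cases hg : 17 / 20 < η g
  -- From `head_le_one`: `(17/20)^2 + 2 * (17/20) * (-η p) < 1`.
  · have : -η p ≤ 1634 / 10000 := by
      nlinarith [a1.η_neg]
    exact ⟨by linarith, p, g, a1, a2, by linarith, this, hg, h.mono _ _ _ a7 (by linarith), a10⟩
  · exfalso
    push Not at hg
    obtain ⟨p', g', b1, b2, b3, b4, b5, b6, b7⟩ := h.exists_opposite_tail (y := η g₀) a1 a2
      (by linarith) a7 (by linarith) a5
      (by rcases a9 with h9 | h9 <;> linarith) (by linarith) (by linarith) le_rfl a10
    have h1 := h.reflect.head_le_one b1 b2 (by linarith)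
    have h2 : 7 / 10 ≤ -η g' := by linarith
    nlinarith

end Approach

namespace Approach

variable {V : Type*} {Adj : V → V → Prop} {ξ η : V → ℝ} {Reach : V → ℝ → Prop} {a t : V}

theorem exists_isTail_source (h : Approach Adj ξ η Reach a t) (ha : η a < 0) :
    ∃ g, IsTail Adj ξ η a g ∧ -η a ≤ 109 / 100 * η g := by
  have h1 : -η a ≤ 1 := by have := h.aη; rwa [abs_of_neg ha] at this
  obtain ⟨g, hg⟩ := h.coords.exists_isStep (u := a) (v := t) (by rw [h.tξ, h.aξ]; norm_num)
    (by rwa [h.tη])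
  have hr := h.reach_of_isStep h.start hg
  have hx := hg.lt_x
  have hy := hg.lt_y
  have hle := hg.le t (by rw [h.tξ, h.aξ]; norm_num) (by rwa [h.tη])
  rw [h.tξ, h.tη, h.aξ] at hle
  rw [h.aξ] at hr hx
  have hfar := h.far g _ hr
  rw [abs_of_neg ha] at hfar
  by_cases hξ : 0 < ξ g
  · rw [abs_of_pos hξ] at hfar
    rcases lt_trichotomy (η g) 0 with hη | hη | hη
    · rw [abs_of_neg hη] at hfar
      rcases hfar with h4 | h4 <;> linarith
    · have : g = t := h.coords.injy (by rw [h.tη, hη])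
      rw [this, h.tξ] at hξ
      exact absurd hξ (lt_irrefl _)
    · rw [abs_of_pos hη] at hfar
      refine ⟨g, ⟨hg, ha, hξ, hη⟩, ?_⟩
      rcases hfar with h4 | h4
      · linarith
      · by_contra! hcon
        have : 9 / 10 ≤ η g := by linarith
        nlinarith
  · exfalso
    push Not at hξ
    have k1 : η g ≤ 0 := by nlinarith
    have k2 : -ξ g ≤ 9 / 20 := by nlinarith
    rw [abs_of_nonpos hξ, abs_of_nonpos k1] at hfar
    rcases hfar with h4 | h4 <;> linarith

/-- A tail of maximal head height, on either side of the axis, cannot be lengthened and so leads to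
a long one. The bound `4212/10000` is `109/100 * 17/44` rounded up. -/
theorem exists_isLongTail_of_neg [Finite V] (h : Approach Adj ξ η Reach a t) (ha : η a < 0) :
    -η a ≤ 4212 / 10000 ∧ ∃ p g, IsLongTail Adj ξ η Reach p g ∨
      IsLongTail Adj ξ (fun v => -η v) Reach p g := by
  classical
  have := Fintype.ofFinite V
  obtain ⟨g, hg, hag⟩ := h.exists_isTail_source ha
  have hg0 := hg.η_pos
  have ha1 : -η a ≤ 17 / 20 := by
    have h1 := h.head_le_one hg (by rw [h.aξ]; norm_num) h.aξ.le
    nlinarith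
  have hra : Reach a (46 / 5 * η g) := h.mono _ _ _ h.start (by linarith)
  constructor
  · by_cases hy : 17 / 44 < η g
    · linarith [(h.exists_isLongTail_of_tail hg (by rw [h.aξ]; norm_num) h.aξ.le hra
        (by linarith) ha1 hy).1]
    · linarith
  let S : Finset (V × V) := Finset.univ.filter fun q =>
    (IsTail Adj ξ η q.1 q.2 ∨ IsTail Adj ξ (fun v => -η v) q.1 q.2) ∧ 0 < ξ q.1 ∧ ξ q.1 ≤ 1 ∧
      Reach q.1 (46 / 5 * |η q.2|) ∧ |η q.1| ≤ 11 / 5 * |η q.2| ∧ |η q.1| ≤ 17 / 20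
  have haS : (a, g) ∈ S := by
    simp only [S, Finset.mem_filter, Finset.mem_univ, true_and]
    rw [abs_of_pos hg0, abs_of_neg ha, h.aξ]
    exact ⟨Or.inl hg, one_pos, le_rfl, hra, by linarith, ha1⟩
  obtain ⟨⟨p₀, g₀⟩, hS, hmax⟩ := S.exists_max_image (fun q => |η q.2|) ⟨_, haS⟩
  simp only [S, Finset.mem_filter, Finset.mem_univ, true_and, Prod.forall] at hS hmax
  obtain ⟨h1 | h1, h2, h3, h4, h5, h6⟩ := hS
  · have e1 := h1.η_neg
    have e2 := h1.η_pos
    rw [abs_of_pos e2] at h4 h5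
    rw [abs_of_neg e1] at h5 h6
    by_cases hy : 17 / 44 < η g₀
    · obtain ⟨p, g, hpg⟩ := (h.exists_isLongTail_of_tail h1 h2 h3 h4 h5 h6 hy).2
      exact ⟨p, g, Or.inl hpg⟩
    · obtain ⟨p, g, k1, k2, k3, k4, k5, k6, k7⟩ :=
        h.exists_longer_tail h1 h2 h3 h4 h5 h6 (not_lt.1 hy)
      have := hmax p g ⟨k1, k2, k3, k4, k5, k6⟩
      rw [abs_of_pos e2] at this
      linarith
  · have e1 := h1.η_neg
    have e2 := h1.η_pos
    rw [← abs_neg (η g₀), abs_of_pos e2] at h4 h5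
    rw [← abs_neg, abs_of_neg e1] at h5 h6
    by_cases hy : 17 / 44 < -η g₀
    · obtain ⟨p, g, hpg⟩ := (h.reflect.exists_isLongTail_of_tail h1 h2 h3 h4 h5 h6 hy).2
      exact ⟨p, g, Or.inr hpg⟩
    · obtain ⟨p, g, k1, k2, k3, k4, k5, k6, k7⟩ :=
        h.reflect.exists_longer_tail h1 h2 h3 h4 h5 h6 (not_lt.1 hy)
      simp only [neg_neg, abs_neg] at k1 k4 k5 k6 k7
      have := hmax p g ⟨k1.symm, k2, k3, k4, k5, k6⟩
      rw [← abs_neg (η g₀), abs_of_pos e2] at this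
      linarith

theorem exists_isLongTail [Finite V] (h : Approach Adj ξ η Reach a t) :
    |η a| ≤ 4212 / 10000 ∧ ∃ p g, IsLongTail Adj ξ η Reach p g ∨
      IsLongTail Adj ξ (fun v => -η v) Reach p g := by
  rcases lt_trichotomy (η a) 0 with ha | ha | ha
  · rw [abs_of_neg ha]
    exact h.exists_isLongTail_of_neg ha
  · have : a = t := h.coords.injy (by rw [h.tη, ha])
    have h1 := h.aξ
    rw [this, h.tξ] at h1
    norm_num at h1
  · obtain ⟨h1, p, g, h2⟩ := h.reflect.exists_isLongTail_of_neg (by linarith)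
    simp only [neg_neg] at h1 h2
    rw [abs_of_pos ha]
    exact ⟨h1, p, g, h2.symm⟩

end Approach

/-! ### Contradiction between the long tails from both ends -/

/-- Two approaches, of the points `a` and `t` to each other, in matching coordinates, such that
points reachable from `a` and points reachable from `t` are not closer to each
other, by a definite proportion of the costs, than `a` and `t` are. -/
structure TwoSided {V : Type*} (Adj : V → V → Prop) (ξ η ξ' η' : V → ℝ) (R R' : V → ℝ → Prop)
    (a t : V) : Prop where
  left : Approach Adj ξ η R a t
  right : Approach Adj ξ' η' R' t a
  ξ_eq : ∀ v, ξ' v = 1 - ξ v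
  η_eq : ∀ v, η' v = η v - η a
  far : ∀ u v c c', R u c → R' v c' → 1 - (c + c') / 490 ≤ |ξ u - ξ v| + |η u - η v| / 20 ∨
    1 - (c + c') / 490 ≤ |η u - η v| + |ξ u - ξ v| / 20

namespace TwoSided

variable {V : Type*} {Adj : V → V → Prop} {ξ η ξ' η' : V → ℝ} {R R' : V → ℝ → Prop} {a t : V}

theorem reflect (h : TwoSided Adj ξ η ξ' η' R R' a t) :
    TwoSided Adj ξ (fun v => -η v) ξ' (fun v => -η' v) R R' a t := by
  refine ⟨h.left.reflect, h.right.reflect, h.ξ_eq, fun v => by linarith [h.η_eq v],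
    fun u v c c' hu hv => ?_⟩
  have : |-η u - -η v| = |η u - η v| := by rw [← abs_neg]; congr 1; ring
  rw [this]
  exact h.far u v c c' hu hv

end TwoSided

theorem IsLongTail.head {V : Type*} {Adj : V → V → Prop} {ξ η : V → ℝ} {R : V → ℝ → Prop}
    {a t p g : V} (hp : IsLongTail Adj ξ η R p g) (h : Approach Adj ξ η R a t) :
    96 / 100 ≤ ξ p ∧ 43 / 100 ≤ ξ g ∧ η g < 1 ∧ R g (138 / 10) := by
  have h1 := h.far_ξ hp.reach (by norm_num) hp.ξ_pos.le hp.ξ_le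
    (by rw [abs_of_neg hp.tail.η_neg]; linarith [hp.le_η])
  rw [abs_of_neg hp.tail.η_neg] at h1
  have h2 := hp.le_η
  have h3 := h.head_lt_one hp.tail hp.ξ_pos hp.ξ_le
  have h4 := hp.tail.step.le t (by rw [h.tξ]; exact hp.ξ_pos) (by rw [h.tη]; exact hp.tail.η_neg)
  rw [h.tξ, h.tη] at h4
  have h5 := hp.lt_η
  have h6 := hp.tail.η_neg
  have h7 := hp.ξ_le
  have h8 : ξ p - ξ g ≤ 53 / 100 := by nlinarith
  exact ⟨by linarith, by linarith, h3,
    h.mono _ _ _ (h.reach_of_isStep hp.reach hp.tail.step) (by linarith)⟩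

namespace TwoSided

variable {V : Type*} {Adj : V → V → Prop} {ξ η ξ' η' : V → ℝ} {R R' : V → ℝ → Prop} {a t : V}

/-- Here `(u, v)` and `(A, B)` are the offsets of `q` and `g` from `p'`, and `P` is the height of
`p'`; `5846/10000` is `1634/10000 + 4212/10000`. -/
theorem overhead_bounds {u v A B P : ℝ} (h : u ^ 2 + v ^ 2 ≤ A ^ 2 + B ^ 2)
    (hA : 39 / 100 ≤ A) (hA1 : A ≤ 1) (hB : 26 / 100 ≤ B) (hB1 : B ≤ 1422 / 1000)
    (hP : P ≤ 5846 / 10000) (hPB : P + B ≤ 1) :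
    v ≤ B + 775 / 1000 ∧ v + P ≤ 167 / 100 ∧ u ≤ 1739 / 1000 ∧ u + v ≤ 247 / 100 := by
  have hA2 : A ^ 2 ≤ 1 := by nlinarith only [hA, hA1]
  have hB2 : B ^ 2 ≤ 2023 / 1000 := by nlinarith only [hB, hB1]
  have hv2 : v ^ 2 ≤ 1 + B ^ 2 := by nlinarith only [h, hA2, sq_nonneg u]
  refine ⟨?_, ?_, ?_, ?_⟩
  · refine abs_le_of_sq_le_sq' ?_ (by linarith only [hB]) |>.2
    nlinarith only [hv2, hB]
  · have : v ≤ 167 / 100 - P := by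
      refine abs_le_of_sq_le_sq' ?_ (by linarith only [hP]) |>.2
      have : B ^ 2 ≤ (1 - P) ^ 2 := pow_le_pow_left₀ (by linarith only [hB]) (by linarith only [hPB]) 2
      nlinarith only [hv2, this, hP]
    linarith only [this]
  · refine abs_le_of_sq_le_sq' ?_ (by norm_num) |>.2
    nlinarith only [h, hA2, hB2, sq_nonneg v]
  · refine abs_le_of_sq_le_sq' ?_ (by norm_num) |>.2
    nlinarith only [h, hA2, hB2, sq_nonneg (u - v)]

theorem not_overhead {u v A B : ℝ} (h : u ^ 2 + v ^ 2 ≤ A ^ 2 + B ^ 2) (hv : 0 < v)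
    (hA : 39 / 100 ≤ A) (hB : 26 / 100 ≤ B) (hB1 : B ≤ 1422 / 1000)
    (hvB : B - v ≤ 3134 / 10000) (hu : 17 / 20 < u - A) : False := by
  have h1 : (17 / 20) * (163 / 100) ≤ (u - A) * (u + A) := by
    apply mul_le_mul <;> linarith only [hu, hA]
  have h2 : (B - v) * (B + v) ≤ 1 := by
    rcases le_total B v with h3 | h3
    · nlinarith only [h3, hv, hB]
    · nlinarith only [mul_nonneg (sub_nonneg.2 h3) (sub_nonneg.2 hB1), h3, hvB]
  nlinarith only [h, h1, h2]

theorem far_of_le (h : TwoSided Adj ξ η ξ' η' R R' a t) {u v : V} {c c' : ℝ} (hu : R u c)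
    (hv : R' v c') (hc : c + c' ≤ 283 / 10) (hξ : |ξ u - ξ v| ≤ 1834 / 1000) (hη : |η u - η v| ≤ 1834 / 1000) :
    17 / 20 < |ξ u - ξ v| ∨ 17 / 20 < |η u - η v| := by
  rcases h.far u v c c' hu hv with h1 | h1
  · left; linarith
  · right; linarith

/-- The point is the end of the step from `p'` towards `g`. If it lies near the line `ξ = 0`, the
empty corner of `p'` makes it high. Otherwise, being far from both `p` and `g` would put it farther
from `p'` than `g` is. -/
theorem exists_overhead_of_opposite (h : TwoSided Adj ξ η ξ' η' R R' a t)
    (ha : |η a| ≤ 4212 / 10000) {p g p' g' : V} (hp : IsLongTail Adj ξ η R p g)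
    (hp' : IsLongTail Adj ξ' (fun v => -η' v) R' p' g') :
    ∃ q, R' q (145 / 10) ∧ 0 ≤ ξ q ∧ ξ q ≤ 6 / 10 ∧ 278 / 1000 ≤ η q ∧
      η q ≤ η g + 775 / 1000 ∧ η q ≤ 167 / 100 := by
  obtain ⟨b1, b2, b3, b4⟩ := hp.head h.left
  obtain ⟨b1', -, -, -⟩ := hp'.head h.right.reflect
  obtain ⟨ha1, ha2⟩ := abs_le.1 ha
  have c1 := hp.lt_η
  have c2 := hp'.le_η
  have c3 := hp'.tail.η_neg
  have c4 := hp.le_η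
  have c5 := hp.tail.η_neg
  have c6 := hp'.ξ_le
  have c7 := hp.ξ_le
  have c8 := hp.tail.step.lt_x
  have d1 := hp'.le
  have hpr := hp.reach
  have hp'r := hp'.reach
  clear hp hp' ha
  simp only [h.η_eq, h.ξ_eq] at b1' c2 c3 c6 d1
  obtain ⟨q, hq⟩ := h.right.coords.exists_isStep (u := p') (v := g)
    (by simp only [h.ξ_eq]; linarith only [b1', b2])
    (by simp only [h.η_eq]; linarith only [c2, ha2, c1])
  have hqr := h.right.reach_of_isStep hp'r hq
  have hqx := hq.lt_x
  have hqy := hq.lt_y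
  have hqg := hq.le g (by simp only [h.ξ_eq]; linarith only [b1', b2])
    (by simp only [h.η_eq]; linarith only [c2, ha2, c1])
  simp only [h.η_eq, h.ξ_eq] at hqr hqx hqy hqg
  have e1 := d1 q hqx (by linarith only [hqy])
  have hq2 : (ξ q - ξ p') ^ 2 + (η q - η p') ^ 2 ≤ (ξ g - ξ p') ^ 2 + (η g - η p') ^ 2 := by
    linarith only [hqg]
  have v0 : 0 < η q - η p' := by linarith only [hqy]
  have A0 : 39 / 100 ≤ ξ g - ξ p' := by linarith only [b2, b1']
  have A1 : ξ g - ξ p' ≤ 1 := by linarith only [c7, c8, c6]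
  have B0 : 26 / 100 ≤ η g - η p' := by linarith only [c1, c2, ha2]
  have B1 : η g - η p' ≤ 1422 / 1000 := by linarith only [b3, c3, ha1]
  obtain ⟨f1, f2, f3, f4⟩ := overhead_bounds (P := η p') hq2 A0 A1 B0 B1
    (by linarith only [c2, ha2]) (by linarith only [b3])
  have hr : R' q (145 / 10) := h.right.mono _ _ _ hqr (by linarith only [f4])
  have f5 : η q ≤ 167 / 100 := by linarith only [f2]
  clear hqr hqg hq d1
  have q0 : 0 ≤ ξ q := by linarith only [hqx, c6]
  suffices hχ : ξ q ≤ 15 / 100 from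
    ⟨q, hr, q0, by linarith only [hχ], by linarith only [e1, hχ, c6, ha1],
      by linarith only [f1], f5⟩
  by_contra! hcon
  have k1 := h.far_of_le hpr hr (by norm_num)
    (abs_le.2 ⟨by linarith only [f3, b1, b1'], by linarith only [q0, c7]⟩)
    (abs_le.2 ⟨by linarith only [f5, c4], by linarith only [c5, c3, ha1, hqy]⟩)
  have k2 := h.far_of_le b4 hr (by norm_num)
    (abs_le.2 ⟨by linarith only [f3, b2, b1'], by linarith only [q0, c7, c8]⟩)
    (abs_le.2 ⟨by linarith only [f5, c1], by linarith only [b3, c3, ha1, hqy]⟩)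
  simp only [lt_abs] at k1 k2
  have k3 : 6866 / 10000 ≤ η q := by
    rcases k1 with (k1 | k1) | (k1 | k1)
    · linarith only [k1, hcon, c7]
    · linarith only [k1, b1, hq2, f3, b1']
    · linarith only [k1, c5, hqy, c3, ha1]
    · linarith only [k1, c4]
  have k4 : 17 / 20 < (ξ q - ξ p') - (ξ g - ξ p') := by
    rcases k2 with (k2 | k2) | (k2 | k2)
    · linarith only [k2, hcon, c7, c8]
    · linarith only [k2]
    · linarith only [k2, b3, k3]
    · linarith only [k2, f1]
  exact not_overhead hq2 v0 A0 B0 B1 (by linarith only [b3, k3]) k4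

theorem exists_overhead (h : TwoSided Adj ξ η ξ' η' R R' a t) (ha : |η a| ≤ 4212 / 10000)
    {p g p' g' : V} (hp : IsLongTail Adj ξ η R p g)
    (hp' : IsLongTail Adj ξ' η' R' p' g' ∨ IsLongTail Adj ξ' (fun v => -η' v) R' p' g') :
    ∃ q, R' q (145 / 10) ∧ 0 ≤ ξ q ∧ ξ q ≤ 6 / 10 ∧ 278 / 1000 ≤ η q ∧
      η q ≤ η g + 775 / 1000 ∧ η q ≤ 167 / 100 := by
  rcases hp' with hp' | hp'
  · obtain ⟨-, b2, b3, b4⟩ := hp'.head h.right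
    obtain ⟨ha1, ha2⟩ := abs_le.1 ha
    have c1 := hp'.lt_η
    have c2 := hp'.ξ_le
    have c3 := hp'.tail.step.lt_x
    have c4 := hp.lt_η
    rw [h.ξ_eq] at b2 c3 c2
    rw [h.ξ_eq] at c3
    rw [h.η_eq] at b3 c1
    exact ⟨g', h.right.mono _ _ _ b4 (by norm_num), by linarith, by linarith, by linarith,
      by linarith, by linarith⟩
  · exact h.exists_overhead_of_opposite ha hp hp'

/-- A step crossing the axis at positive `ξ` would land either in the step quadrant of `p`, nearer
than `g`, or in the empty corner of `p`. -/
theorem nonpos_of_isStep (h : Approach Adj ξ η R a t) {p g s w : V}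
    (hp : IsLongTail Adj ξ η R p g) (hs0 : 0 < ξ s) (hsp : ξ s < ξ p)
    (hsη : 3 / 4 ≤ η s) (hw : IsStep Adj ξ (fun v => -η v) s w)
    {c : ℝ} (hr : R w c) (hc : c ≤ 19) (hb : ¬ (0 < ξ w ∧ -η w < 0)) : ξ w ≤ 0 := by
  by_contra! hξ
  have c4 := hp.le_η
  have c5 := hp.tail.η_neg
  have c6 := hp.ξ_le
  have w1 := hw.lt_x
  have hw0 : η w < 0 := by
    refine lt_of_le_of_ne (not_lt.1 fun h' => hb ⟨hξ, by linarith only [h']⟩) fun h' => ?_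
    have : w = t := h.coords.injy (by rw [h.tη, h'])
    rw [this, h.tξ] at hξ
    exact lt_irrefl _ hξ
  have ht : IsTail Adj ξ (fun v => -η v) s w :=
    ⟨hw, by linarith only [hsη], hξ, by linarith only [hw0]⟩
  have hle : (-η w) ^ 2 - 2 * -η w * -η s < 1 :=
    h.reflect.head_le_one ht hs0 (by linarith only [hsp, c6])
  have hm : 0 ≤ (η s - 3 / 4) * -η w :=
    mul_nonneg (by linarith only [hsη]) (by linarith only [hw0])
  have hwm : -η w < 3 / 5 := by nlinarith only [hle, hm, hw0]
  have hF := h.far_ξ hr (by linarith only [hc]) hξ.le (by linarith only [w1, hsp, c6])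
    (by rw [abs_of_neg hw0]; linarith only [hwm])
  rw [abs_of_neg hw0] at hF
  have hwp : η w < η p := by
    refine lt_of_le_of_ne ?_ fun h' => ?_
    · by_contra! hcon
      have h1 := hp.tail.le_add (z := w) (by linarith only [w1, hsp]) hcon
      have h2 := h.far_l1 hr
      rw [abs_of_pos hξ, abs_of_neg hw0] at h2
      linarith only [h1, h2, hF, c4, hcon, hw0, hc, c6, c4, hp.lt_η]
    · have := h.coords.injy h'
      rw [this] at w1
      linarith only [w1, hsp]
  have hL := hp.le w (by linarith only [w1, hsp]) hwp
  linarith only [hL, hF, hwm, hc, c6]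

theorem exit_bound {x z X Y : ℝ} (h : X ^ 2 + 2 * x * X + Y ^ 2 ≤ 2 * z * Y)
    (hx : 895 / 1000 ≤ x) (hz : 0 ≤ z) (hz1 : z < 1) (hX : 0 ≤ X) : 0 ≤ Y ∧ X ≤ 45 / 100 := by
  have h1 : X ^ 2 + 2 * x * X ≤ 1 := by nlinarith only [h, sq_nonneg (z - Y), hz, hz1]
  refine ⟨?_, ?_⟩
  · by_contra! hY
    nlinarith only [h, mul_nonneg hz (neg_nonneg.2 hY.le), mul_nonneg hX (le_trans (by norm_num) hx),
      mul_pos_of_neg_of_neg hY hY, sq_nonneg X]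
  · by_contra! hcon
    nlinarith only [h1, mul_nonneg hX (sub_nonneg.2 hx), hcon]

/-- The chain down from `g` ends at some `s` still nearly as high as `g` or above `17/20`. The next
step passes over `t` to `ξ ≤ 0` and, by `far`, stays high; so it ends near `q`, contradicting
`TwoSided.far`. -/
theorem false_of_overhead [Finite V] (h : TwoSided Adj ξ η ξ' η' R R' a t)
    {p g q : V} (hp : IsLongTail Adj ξ η R p g) (hq : R' q (145 / 10)) (q1 : 0 ≤ ξ q)
    (q2 : ξ q ≤ 6 / 10) (q3 : 278 / 1000 ≤ η q) (q4 : η q ≤ η g + 775 / 1000)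
    (q5 : η q ≤ 167 / 100) : False := by
  obtain ⟨b1, b2, b3, b4⟩ := hp.head h.left
  have c1 := hp.lt_η
  have c4 := hp.le_η
  have c5 := hp.tail.η_neg
  have c6 := hp.ξ_le
  have c7 := hp.tail.step.lt_x
  obtain ⟨s, w, k1, k2, k3, k4, k5, k6, k7⟩ :=
    h.left.reflect.chain_up (s := g) (by linarith only [b2])
      (by linarith only [c1]) b4
  simp only [neg_le_neg_iff, neg_lt_zero] at k2 k3
  have s1 := hp.tail.le_add (z := s) (by linarith only [k1, c7]) (by linarith only [c5, k3])
  have s2 : η g - 76 / 1000 ≤ η s ∨ 17 / 20 < η s := by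
    refine or_iff_not_imp_right.2 fun h' => ?_
    push Not at h'
    have := h.left.far_ξ k6 (by linarith only [k1, k4, k2, k3, c6, c7, b3])
      k4.le (by linarith only [k1, c6, c7]) (by rw [abs_of_pos k3]; exact h')
    rw [abs_of_pos k3] at this
    linarith only [this, s1, k1, k2, c6, c7, b3, c4, h', k4, k3]
  have s3 : 3 / 4 ≤ η s := by
    rcases s2 with h' | h'
    · linarith only [h', c1]
    · linarith only [h']
  have hsr : R s (15 + 3 / 5) := h.left.mono _ _ _ k6 (by linarith only [s1, k1, k2, k4, c6, c7, b3, s3])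
  have hwr := h.left.reflect.reach_of_isStep hsr k5
  have w1 := k5.lt_x
  have w2 := k5.lt_y
  have w3 := k5.le t (by rw [h.left.tξ]; exact k4) (by rw [h.left.tη]; linarith only [k3])
  simp only [h.left.tξ, h.left.tη, neg_lt_neg_iff] at hwr w2 w3
  have hsp : ξ s < ξ p := by linarith only [k1, c7]
  have hs1 : η s < 1 := by linarith only [k2, b3]
  have hx : |ξ s - ξ q| ≤ 1 :=
    abs_le.2 ⟨by linarith only [k4, q2], by linarith only [hsp, c6, q1]⟩
  have f1 : 895 / 1000 ≤ ξ s - ξ q := by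
    have hy : |η s - η q| ≤ 852 / 1000 := by
      refine abs_le.2 ⟨?_, by linarith only [hs1, q3]⟩
      rcases s2 with h' | h'
      · linarith only [h', q4]
      · linarith only [h', q5]
    have : 895 / 1000 ≤ |ξ s - ξ q| := by
      rcases h.far _ _ _ _ hsr hq with h' | h'
      · linarith only [h', hy]
      · linarith only [h', hy, hx]
    rcases le_abs.1 this with h' | h'
    · exact h'
    · linarith only [h', q2, k4]
  have hwc : -η w < 1 := by
    by_contra! hcon
    nlinarith only [w3, hcon, k3, hsp, c6, k4, sq_nonneg (ξ s - ξ w), s3]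
  have hexit : ξ w ≤ 0 := by
    rcases le_or_gt (ξ w) 0 with hξ | hξ
    · exact hξ
    · exact nonpos_of_isStep h.left hp k4 hsp s3 k5 hwr
        (by linarith only [hξ, hsp, c6, hs1, hwc]) k7
  obtain ⟨w5, f2⟩ := exit_bound (x := ξ s) (z := η s) (X := -ξ w) (Y := η w)
    (by linarith only [w3]) (by linarith only [f1, q1]) k3.le hs1 (neg_nonneg.2 hexit)
  have hwr' : R w (181 / 10) := h.left.mono _ _ _ hwr (by linarith only [f2, hsp, c6, w5, hs1])
  have f3 : 9 / 10 ≤ η w := by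
    have h1 := h.left.far _ _ hwr'
    rw [abs_of_nonpos hexit, abs_of_nonneg w5] at h1
    rcases h1 with h1 | h1
    · linarith only [h1, f2, abs_nonneg (η a), w2, hs1]
    · linarith only [h1, f2, abs_nonneg (η a)]
  have g1 : |ξ w - ξ q| ≤ 6 / 10 :=
    abs_le.2 ⟨by linarith only [f1, f2, hsp, c6], by linarith only [hexit, q1]⟩
  have g2 : |η w - η q| ≤ 8 / 10 :=
    abs_le.2 ⟨by linarith only [f3, q5], by linarith only [w2, hs1, q3]⟩
  rcases h.far _ _ _ _ hwr' hq with h1 | h1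
  · linarith only [h1, g1, g2]
  · linarith only [h1, g1, g2]

theorem false_of_isLongTail [Finite V] (h : TwoSided Adj ξ η ξ' η' R R' a t)
    (ha : |η a| ≤ 4212 / 10000) {p g p' g' : V} (hp : IsLongTail Adj ξ η R p g)
    (hp' : IsLongTail Adj ξ' η' R' p' g' ∨ IsLongTail Adj ξ' (fun v => -η' v) R' p' g') :
    False := by
  obtain ⟨q, hq, q1, q2, q3, q4, q5⟩ := h.exists_overhead ha hp hp'
  exact h.false_of_overhead hp hq q1 q2 q3 q4 q5

theorem elim [Finite V] (h : TwoSided Adj ξ η ξ' η' R R' a t) : False := by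
  obtain ⟨ha, p, g, hp⟩ := h.left.exists_isLongTail
  obtain ⟨-, p', g', hp'⟩ := h.right.exists_isLongTail
  rcases hp with hp | hp
  · exact h.false_of_isLongTail ha hp hp'
  · exact h.reflect.false_of_isLongTail (by simpa using ha) hp (by simpa using hp'.symm)

end TwoSided

/-! ### The comparison norm and the minimal counterexample -/

/-- A norm on the plane which is close to the maximum norm, as a function of the coordinates. -/
noncomputable def nearMax (x y : ℝ) : ℝ := max |x| |y| + min |x| |y| / 20

theorem nearMax_comm (x y : ℝ) : nearMax x y = nearMax y x := by
  rw [nearMax, nearMax, max_comm, min_comm]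

theorem nearMax_of_le {x y : ℝ} (h : |y| ≤ |x|) : nearMax x y = |x| + |y| / 20 := by
  rw [nearMax, max_eq_left h, min_eq_right h]

theorem nearMax_lt {x y c : ℝ} (h1 : |x| + |y| / 20 < c) (h2 : |y| + |x| / 20 < c) :
    nearMax x y < c := by
  rcases le_total |y| |x| with h | h
  · rwa [nearMax_of_le h]
  · rwa [nearMax_comm, nearMax_of_le h]

theorem nearMax_le {x y d : ℝ} (hd : 0 ≤ d) (h : x ^ 2 + y ^ 2 = d ^ 2) :
    490 * nearMax x y ≤ 491 * d := by
  wlog hxy : |y| ≤ |x| generalizing x y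
  · rw [nearMax_comm]
    exact this (by linarith) (le_of_not_ge hxy)
  rw [nearMax_of_le hxy]
  have hx := abs_nonneg x
  have hy := abs_nonneg y
  rw [← sq_abs x, ← sq_abs y] at h
  -- Cauchy–Schwarz gives the factor `√(1 + 1/400)`, which is below `491/490`.
  refine abs_le_of_sq_le_sq' ?_ (by positivity) |>.2
  nlinarith only [h, sq_nonneg (|x| / 20 - |y|), sq_nonneg |x|, sq_nonneg |y|]

/-- A relation `D u v c`, meaning that `v` can be reached from `u` at cost `c`, for which
edges may be used in both directions at the cost of their lengths in the `ℓ¹` norm. -/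
structure IsTravelCost {V : Type*} (Adj : V → V → Prop) (X Y : V → ℝ) (D : V → V → ℝ → Prop) :
    Prop where
  nonneg : ∀ {u v c}, D u v c → 0 ≤ c
  refl : ∀ u, D u u 0
  mono : ∀ {u v c c'}, D u v c → c ≤ c' → D u v c'
  symm : ∀ {u v c}, D u v c → D v u c
  trans : ∀ {u v w c c'}, D u v c → D v w c' → D u w (c + c')
  adj : ∀ {u v}, Adj u v → D u v (|X v - X u| + |Y v - Y u|)

namespace IsTravelCost

variable {V : Type*} {Adj : V → V → Prop} {X Y : V → ℝ} {D : V → V → ℝ → Prop}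

theorem swap (h : IsTravelCost Adj X Y D) : IsTravelCost Adj Y X D :=
  ⟨h.nonneg, h.refl, h.mono, h.symm, h.trans, fun huv => by rw [add_comm]; exact h.adj huv⟩

theorem false_of_minimal [Finite V] (h : IsTravelCost Adj X Y D) (hc : IsYaoCoords Adj X Y)
    {a t : V} (hat : a ≠ t) (hle : |Y a - Y t| ≤ |X a - X t|)
    (hmin : ∀ u v, nearMax (X u - X v) (Y u - Y v) < nearMax (X a - X t) (Y a - Y t) →
      D u v (490 * nearMax (X u - X v) (Y u - Y v)))
    (hbad : ¬ D a t (490 * nearMax (X a - X t) (Y a - Y t))) : False := by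
  rw [nearMax_of_le hle] at hmin hbad
  obtain ⟨e, he, hS⟩ : ∃ e : ℝ, (e = 1 ∨ e = -1) ∧ |X a - X t| = e * (X a - X t) := by
    rcases abs_choice (X a - X t) with h1 | h1
    · exact ⟨1, Or.inl rfl, by rw [h1, one_mul]⟩
    · exact ⟨-1, Or.inr rfl, by rw [h1]; ring⟩
  have he' : -e = 1 ∨ -e = -1 := by rcases he with rfl | rfl <;> norm_num
  have hea : |e| = 1 := by rcases he with rfl | rfl <;> norm_num
  have hS0 : 0 < |X a - X t| := abs_pos.2 (sub_ne_zero.2 (hc.injx.ne hat))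
  obtain ⟨S, hSd⟩ : ∃ S, S = |X a - X t| := ⟨_, rfl⟩
  rw [← hSd] at hS hS0 hle hmin hbad
  have hne : S ≠ 0 := hS0.ne'
  let ξ : V → ℝ := fun v => S⁻¹ * (e * X v) + -(S⁻¹ * (e * X t))
  let η : V → ℝ := fun v => S⁻¹ * (1 * Y v) + -(S⁻¹ * Y t)
  let ξ' : V → ℝ := fun v => S⁻¹ * (-e * X v) + S⁻¹ * (e * X a)
  let η' : V → ℝ := fun v => S⁻¹ * (1 * Y v) + -(S⁻¹ * Y a)
  have hξ : ∀ u v, ξ u - ξ v = S⁻¹ * (e * (X u - X v)) := fun u v => by simp only [ξ]; ring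
  have hη : ∀ u v, η u - η v = S⁻¹ * (Y u - Y v) := fun u v => by simp only [η]; ring
  have tξ : ξ t = 0 := by simp only [ξ]; ring
  have tη : η t = 0 := by simp only [η]; ring
  have aξ : ξ a = 1 := by
    have := hξ a t
    rw [tξ, ← hS, inv_mul_cancel₀ hne] at this
    linarith
  have ξ_eq : ∀ v, ξ' v = 1 - ξ v := fun v => by rw [← aξ, hξ]; simp only [ξ']; ring
  have η_eq : ∀ v, η' v = η v - η a := fun v => by rw [hη]; simp only [η']; ring
  have hξa : ∀ u v, S * |ξ u - ξ v| = |X u - X v| := fun u v => by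
    rw [hξ, abs_mul, abs_mul, hea, abs_of_pos (inv_pos.2 hS0)]; field_simp
  have hηa : ∀ u v, S * |η u - η v| = |Y u - Y v| := fun u v => by
    rw [hη, abs_mul, abs_of_pos (inv_pos.2 hS0)]; field_simp
  have hηa0 : S * |η a| = |Y a - Y t| := by rw [← hηa, tη, sub_zero]
  have hη1 : |η a| ≤ 1 := le_of_mul_le_mul_left (by rw [hηa0, mul_one]; exact hle) hS0
  have far : ∀ u v c c', D a u (S * c) → D t v (S * c') →
      1 + |η a| / 20 - (c + c') / 490 ≤ |ξ u - ξ v| + |η u - η v| / 20 ∨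
      1 + |η a| / 20 - (c + c') / 490 ≤ |η u - η v| + |ξ u - ξ v| / 20 := by
    intro u v c c' hu hv
    by_contra! hcon
    have h1 := mul_lt_mul_of_pos_left hcon.1 hS0
    have h2 := mul_lt_mul_of_pos_left hcon.2 hS0
    have h3 := h.nonneg hu
    have h4 := h.nonneg hv
    have h5 := hξa u v
    have h6 := hηa u v
    have hlt : nearMax (X u - X v) (Y u - Y v) <
        S + |Y a - Y t| / 20 - (S * c + S * c') / 490 :=
      nearMax_lt (by linarith) (by linarith)
    -- Minimality joins `u` to `v`; going `a`, `u`, `v`, `t` then beats the bound that fails for `a`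
    -- and `t`.
    exact hbad (h.mono (h.trans (h.trans hu (hmin u v (by linarith))) (h.symm hv)) (by linarith))
  have step : ∀ b u w c, D b u (S * c) → Adj u w →
      D b w (S * (c + |ξ w - ξ u| + |η w - η u|)) := fun b u w c hu hw =>
    h.mono (h.trans hu (h.adj hw)) (by rw [← hξa, ← hηa]; linarith)
  have step' : ∀ b u w c, D b u (S * c) → Adj u w →
      D b w (S * (c + |ξ' w - ξ' u| + |η' w - η' u|)) := fun b u w c hu hw => by
    rw [ξ_eq, ξ_eq, η_eq, η_eq, sub_sub_sub_cancel_left, sub_sub_sub_cancel_right, abs_sub_comm]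
    exact step b u w c hu hw
  refine TwoSided.elim (Adj := Adj) (ξ := ξ) (η := η) (ξ' := ξ') (η' := η')
    (R := fun u c => D a u (S * c)) (R' := fun u c => D t u (S * c)) (a := a) (t := t)
    ⟨⟨hc.affine he (Or.inl rfl) (inv_pos.2 hS0) _ _, tξ, tη, aξ, hη1, ?_, ?_, step a, ?_⟩,
      ⟨hc.affine he' (Or.inl rfl) (inv_pos.2 hS0) _ _, ?_, ?_, ?_, ?_, ?_, ?_, step' t, ?_⟩,
      ξ_eq, η_eq, ?_⟩
  · simpa using h.refl a
  · exact fun u c c' hu hcc => h.mono hu (mul_le_mul_of_nonneg_left hcc hS0.le)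
  · intro u c hu
    simpa [tξ, tη] using far u t c 0 hu (by simpa using h.refl t)
  · rw [ξ_eq, aξ, sub_self]
  · rw [η_eq, sub_self]
  · rw [ξ_eq, tξ, sub_zero]
  · rw [η_eq, tη, zero_sub, abs_neg]; exact hη1
  · simpa using h.refl t
  · exact fun u c c' hu hcc => h.mono hu (mul_le_mul_of_nonneg_left hcc hS0.le)
  · intro u c hu
    have := far a u 0 c (by simpa using h.refl a) hu
    rwa [aξ, ← ξ_eq, abs_sub_comm (η a), ← η_eq, zero_add, ← abs_neg (η a), ← zero_sub (η a),
      ← tη, ← η_eq] at this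
  · intro u v c c' hu hv
    have := abs_nonneg (η a)
    rcases far u v c c' hu hv with h1 | h1
    · left; linarith
    · right; linarith

theorem le_nearMax [Finite V] (h : IsTravelCost Adj X Y D) (hc : IsYaoCoords Adj X Y) (a t : V) :
    D a t (490 * nearMax (X a - X t) (Y a - Y t)) := by
  classical
  have := Fintype.ofFinite V
  by_contra hbad
  let B : Finset (V × V) := Finset.univ.filter fun p =>
    ¬ D p.1 p.2 (490 * nearMax (X p.1 - X p.2) (Y p.1 - Y p.2))
  obtain ⟨⟨u, v⟩, huv, hmin⟩ := B.exists_min_image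
    (fun p => nearMax (X p.1 - X p.2) (Y p.1 - Y p.2)) ⟨(a, t), by simpa [B] using hbad⟩
  simp only [B, Finset.mem_filter, Finset.mem_univ, true_and, Prod.forall] at huv hmin
  have hmin' : ∀ p q, nearMax (X p - X q) (Y p - Y q) < nearMax (X u - X v) (Y u - Y v) →
      D p q (490 * nearMax (X p - X q) (Y p - Y q)) := fun p q hpq => by
    by_contra hcon
    exact absurd (hmin p q hcon) (not_le.2 hpq)
  have hne : u ≠ v := by
    rintro rfl
    exact huv (by simpa [nearMax] using h.refl u)
  rcases le_total |Y u - Y v| |X u - X v| with hle | hle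
  · exact h.false_of_minimal hc hne hle hmin' huv
  · refine h.swap.false_of_minimal hc.swap hne hle (fun p q hpq => ?_) ?_
    · rw [nearMax_comm] at hpq ⊢
      rw [nearMax_comm (Y u - Y v)] at hpq
      exact hmin' p q hpq
    · rwa [nearMax_comm]

end IsTravelCost

/-! ### Rotation to general position -/

section Perturbation

theorem eventually_mul_abs_lt {ι : Type*} [Finite ι] (f g : ι → ℝ) :
    ∀ᶠ ε in nhdsWithin (0 : ℝ) (Set.Ioi 0), ∀ i, f i ≠ 0 → ε * |g i| < |f i| := by
  refine Filter.eventually_all.2 fun i => ?_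
  by_cases hf : f i = 0
  · exact Filter.Eventually.of_forall fun ε h => absurd hf h
  · have h1 : Filter.Tendsto (fun ε : ℝ => ε * |g i|) (nhdsWithin 0 (Set.Ioi 0)) (nhds 0) := by
      have : Continuous fun ε : ℝ => ε * |g i| := by fun_prop
      simpa using (this.tendsto 0).mono_left nhdsWithin_le_nhds
    filter_upwards [h1.eventually_lt_const (abs_pos.2 hf)] with ε hε _ using hε

theorem exists_perturbation {ι : Type*} [Finite ι] (x y : ι → ℝ) :
    ∃ ε : ℝ, 0 < ε ∧ (∀ i j, x i - x j ≠ 0 → ε * |y i - y j| < |x i - x j|) ∧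
      ∀ i j, y i - y j ≠ 0 → ε * |x i - x j| < |y i - y j| := by
  have h1 := eventually_mul_abs_lt (fun p : ι × ι => x p.1 - x p.2) fun p => y p.1 - y p.2
  have h2 := eventually_mul_abs_lt (fun p : ι × ι => y p.1 - y p.2) fun p => x p.1 - x p.2
  obtain ⟨ε, ⟨h3, h4⟩, h5⟩ := ((h1.and h2).and self_mem_nhdsWithin).exists
  exact ⟨ε, h5, fun i j => h3 (i, j), fun i j => h4 (i, j)⟩

/-- A small turn moves the included boundary ray into the open quadrant and the excluded one out of
it; `ε` is too small to change the sign of a nonzero coordinate. -/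
theorem rotate_pos_iff {ε p q : ℝ} (hε : 0 < ε) (hp : p ≠ 0 → ε * |q| < |p|)
    (hq : q ≠ 0 → ε * |p| < |q|) : 0 < p - ε * q ∧ 0 < q + ε * p ↔ 0 < p ∧ 0 ≤ q := by
  have hq' := mul_le_mul_of_nonneg_left (le_abs_self q) hε.le
  have hq'' := mul_le_mul_of_nonneg_left (neg_le_abs q) hε.le
  have hp' := mul_le_mul_of_nonneg_left (le_abs_self p) hε.le
  have hp'' := mul_le_mul_of_nonneg_left (neg_le_abs p) hε.le
  constructor
  · rintro ⟨h1, h2⟩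
    have hp0 : 0 < p := by
      by_contra! hcon
      rcases hcon.lt_or_eq with h3 | h3
      · have := hp h3.ne
        rw [abs_of_neg h3] at this
        linarith
      · subst h3
        rw [mul_zero, add_zero] at h2
        linarith [mul_pos hε h2]
    refine ⟨hp0, ?_⟩
    by_contra! hcon
    have := hq hcon.ne
    rw [abs_of_neg hcon] at this
    linarith
  · rintro ⟨h1, h2⟩
    have := hp h1.ne'
    rw [abs_of_pos h1] at this
    exact ⟨by linarith, by linarith [mul_pos hε h1]⟩

theorem eq_zero_of_eq_mul {ε p q : ℝ} (hε : 0 < ε) (hp : p ≠ 0 → ε * |q| < |p|)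
    (h : p = ε * q) : p = 0 ∧ q = 0 := by
  have h0 : p = 0 := by
    by_contra hne
    have := hp hne
    rw [h, abs_mul, abs_of_pos hε] at this
    exact lt_irrefl _ this
  exact ⟨h0, (mul_eq_zero.1 (h.symm.trans h0)).resolve_left hε.ne'⟩

end Perturbation

section Quadrants

variable {b : OrthonormalBasis (Fin 2) ℝ Plane}

theorem InQuadrant.unique {i j : Fin 4} {u v : Plane} (hi : InQuadrant b i u v)
    (hj : InQuadrant b j u v) : i = j := by
  fin_cases i <;> fin_cases j <;> simp only [InQuadrant] at hi hj <;> first | rfl | linarith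

theorem dist_sq_eq (b : OrthonormalBasis (Fin 2) ℝ Plane) (u v : Plane) :
    dist u v ^ 2 = (b.repr v 0 - b.repr u 0) ^ 2 + (b.repr v 1 - b.repr u 1) ^ 2 := by
  rw [dist_comm, ← b.repr.dist_map, EuclideanSpace.dist_eq, Real.sq_sqrt (by positivity),
    Fin.sum_univ_two, Real.dist_eq, Real.dist_eq, sq_abs, sq_abs]

theorem eq_of_repr_eq (b : OrthonormalBasis (Fin 2) ℝ Plane) {u v : Plane}
    (h0 : b.repr u 0 = b.repr v 0) (h1 : b.repr u 1 = b.repr v 1) : u = v := by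
  have := dist_sq_eq b u v
  rw [h0, h1, sub_self, sub_self] at this
  exact dist_eq_zero.1 (by simpa using this)

theorem exists_quadrant {V : Finset Plane} {ε : ℝ} (hε : 0 < ε)
    (hx : ∀ u v : V, b.repr u 0 - b.repr v 0 ≠ 0 →
      ε * |b.repr u 1 - b.repr v 1| < |b.repr u 0 - b.repr v 0|)
    (hy : ∀ u v : V, b.repr u 1 - b.repr v 1 ≠ 0 →
      ε * |b.repr u 0 - b.repr v 0| < |b.repr u 1 - b.repr v 1|)
    {s r : ℝ} (hs : s = 1 ∨ s = -1) (hr : r = 1 ∨ r = -1) :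
    ∃ i, ∀ u v : V, InQuadrant b i u v ↔
      0 < s * ((b.repr v 0 - ε * b.repr v 1) - (b.repr u 0 - ε * b.repr u 1)) ∧
      0 < r * ((b.repr v 1 + ε * b.repr v 0) - (b.repr u 1 + ε * b.repr u 0)) := by
  have hx' : ∀ u v : V, -(b.repr u 0 - b.repr v 0) ≠ 0 →
      ε * |b.repr u 1 - b.repr v 1| < |b.repr u 0 - b.repr v 0| :=
    fun u v h => hx u v (neg_ne_zero.1 h)
  have hy' : ∀ u v : V, -(b.repr u 1 - b.repr v 1) ≠ 0 →
      ε * |b.repr u 0 - b.repr v 0| < |b.repr u 1 - b.repr v 1| :=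
    fun u v h => hy u v (neg_ne_zero.1 h)
  rcases hs with rfl | rfl <;> rcases hr with rfl | rfl
  · refine ⟨0, fun u v => ?_⟩
    simp only [InQuadrant, map_sub, PiLp.sub_apply]
    rw [← rotate_pos_iff hε (hx v u) (hy v u)]
    exact and_congr (by ring_nf) (by ring_nf)
  · refine ⟨3, fun u v => ?_⟩
    simp only [InQuadrant, map_sub, PiLp.sub_apply]
    rw [and_comm, ← neg_pos, ← rotate_pos_iff hε (by simpa only [abs_neg] using hy' v u)
      (by simpa only [abs_neg] using hx v u), and_comm]
    exact and_congr (by ring_nf) (by ring_nf)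
  · refine ⟨1, fun u v => ?_⟩
    simp only [InQuadrant, map_sub, PiLp.sub_apply]
    rw [and_comm, ← neg_nonneg, ← rotate_pos_iff hε (by simpa only [abs_neg] using hy v u)
      (by simpa only [abs_neg] using hx' v u), and_comm]
    exact and_congr (by ring_nf) (by ring_nf)
  · refine ⟨2, fun u v => ?_⟩
    simp only [InQuadrant, map_sub, PiLp.sub_apply]
    rw [← neg_pos, ← neg_nonneg, ← rotate_pos_iff hε (by simpa only [abs_neg] using hx' v u)
      (by simpa only [abs_neg] using hy' v u)]
    exact and_congr (by ring_nf) (by ring_nf)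

end Quadrants

/-! ### Walk lengths and the spanner bound -/

section Walks

variable {V : Finset Plane} {H : SimpleGraph V}

theorem walkLength_append {u v w : V} (p : H.Walk u v) (q : H.Walk v w) :
    walkLength (p.append q) = walkLength p + walkLength q := by
  simp [walkLength]

theorem walkLength_nonneg {u v : V} (p : H.Walk u v) : 0 ≤ walkLength p :=
  List.sum_nonneg fun x hx => by
    obtain ⟨d, -, rfl⟩ := List.mem_map.1 hx
    exact dist_nonneg

theorem walkLength_reverse {u v : V} (p : H.Walk u v) : walkLength p.reverse = walkLength p := by
  induction p with
  | nil => rfl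
  | cons h p ih =>
    rw [SimpleGraph.Walk.reverse_cons, walkLength_append, ih]
    simp [walkLength, add_comm, dist_comm]

theorem walkLength_bypass_le {u v : V} [DecidableEq V] (p : H.Walk u v) :
    walkLength p.bypass ≤ walkLength p := by
  induction p with
  | nil => rfl
  | @cons u w v h p ih =>
    have h1 : walkLength (SimpleGraph.Walk.cons h p) = dist u w + walkLength p := by
      simp [walkLength]
    have h0 : 0 ≤ dist u w := dist_nonneg
    rw [SimpleGraph.Walk.bypass, h1]
    split_ifs with hs
    · have h2 := walkLength_append (p.bypass.takeUntil u hs) (p.bypass.dropUntil u hs)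
      rw [SimpleGraph.Walk.take_spec] at h2
      linarith [walkLength_nonneg (p.bypass.takeUntil u hs)]
    · have h2 : walkLength (SimpleGraph.Walk.cons h p.bypass) = dist u w + walkLength p.bypass := by
        simp [walkLength]
      linarith

theorem isTravelCost_walkLength {X Y : V → ℝ} {k : ℝ} (hk : 0 ≤ k)
    (hd : ∀ u v, (k * dist u v) ^ 2 = (X v - X u) ^ 2 + (Y v - Y u) ^ 2) :
    IsTravelCost H.Adj X Y fun u v c => ∃ p : H.Walk u v, k * walkLength p ≤ c where
  nonneg := fun ⟨p, hp⟩ => (mul_nonneg hk (walkLength_nonneg p)).trans hp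
  refl u := ⟨.nil, by simp [walkLength]⟩
  mono := fun ⟨p, hp⟩ h => ⟨p, hp.trans h⟩
  symm := fun ⟨p, hp⟩ => ⟨p.reverse, by rwa [walkLength_reverse]⟩
  trans := fun ⟨p, hp⟩ ⟨q, hq⟩ => ⟨p.append q, by rw [walkLength_append]; linarith⟩
  adj {u v} h := ⟨h.toWalk, by
    have h1 : walkLength h.toWalk = dist u v := by simp [walkLength]
    rw [h1]
    exact le_add_of_sq_le_sq_add_sq (abs_nonneg _) (abs_nonneg _)
      (by rw [sq_abs, sq_abs]; exact (hd u v).le)⟩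

end Walks

theorem IsYaoFour.exists_isYaoCoords {b : OrthonormalBasis (Fin 2) ℝ Plane} {V : Finset Plane}
    {E : V → V → Prop} (hE : IsYaoFour b V E) : ∃ (X Y : V → ℝ) (k : ℝ), 0 < k ∧
      (∀ u v, (k * dist u v) ^ 2 = (X v - X u) ^ 2 + (Y v - Y u) ^ 2) ∧
      IsYaoCoords (undirected E).Adj X Y := by
  obtain ⟨ε, hε, hx, hy⟩ := exists_perturbation (fun u : V => b.repr u 0) fun u => b.repr u 1
  let X : V → ℝ := fun u => b.repr u 0 - ε * b.repr u 1
  let Y : V → ℝ := fun u => b.repr u 1 + ε * b.repr u 0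
  have hd : ∀ u v, (√(1 + ε ^ 2) * dist u v) ^ 2 = (X v - X u) ^ 2 + (Y v - Y u) ^ 2 := by
    intro u v
    rw [mul_pow, Real.sq_sqrt (by positivity), Subtype.dist_eq, dist_sq_eq b]
    simp only [X, Y]
    ring
  have inj : ∀ u v : V, u ≠ v → X u ≠ X v ∧ Y u ≠ Y v := by
    intro u v huv
    refine ⟨fun h => huv ?_, fun h => huv ?_⟩
    · obtain ⟨h1, h2⟩ := eq_zero_of_eq_mul hε (hx u v)
        (by simp only [X] at h; linarith)
      exact Subtype.ext (eq_of_repr_eq b (by linarith) (by linarith))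
    · obtain ⟨h1, h2⟩ := eq_zero_of_eq_mul (q := -(b.repr u 0 - b.repr v 0)) hε
        (by simpa only [abs_neg] using hy u v) (by simp only [Y] at h; linarith)
      exact Subtype.ext (eq_of_repr_eq b (by linarith) (by linarith))
  refine ⟨X, Y, √(1 + ε ^ 2), by positivity, hd, ⟨fun u v h => ?_, fun u v h => ?_, ?_⟩⟩
  · by_contra hne
    exact (inj u v hne).1 h
  · by_contra hne
    exact (inj u v hne).2 h
  intro s r hs hr u v hv1 hv2
  obtain ⟨i, hi⟩ := exists_quadrant hε hx hy hs hr
  obtain ⟨w, ⟨hw, hEw⟩, -⟩ := hE.pick u i ⟨v, (hi u v).2 ⟨hv1, hv2⟩⟩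
  obtain ⟨j, hj, hmin⟩ := hE.shortest u w hEw
  obtain rfl := hw.unique hj
  obtain ⟨hw1, hw2⟩ := (hi u w).1 hw
  refine ⟨w, ?_, hw1, hw2, fun z hz1 hz2 => ?_⟩
  · rw [undirected, SimpleGraph.fromRel_adj]
    refine ⟨?_, Or.inl hEw⟩
    rintro rfl
    simp at hw1
  · rw [← hd, ← hd]
    have := hmin z ((hi u z).2 ⟨hz1, hz2⟩)
    gcongr

theorem mainTheorem1 (b : OrthonormalBasis (Fin 2) ℝ Plane) (V : Finset Plane)
    (E : V → V → Prop) (hE : IsYaoFour b V E)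
    (t : ℝ) (ht : 8 * (29 + 23 * Real.sqrt 2) ≤ t) :
    IsSpanner (undirected E) t := by
  classical
  obtain ⟨X, Y, k, hk, hd, hc⟩ := hE.exists_isYaoCoords
  intro u v
  obtain ⟨p, hp⟩ := (isTravelCost_walkLength (H := undirected E) hk.le hd).le_nearMax hc u v
  refine ⟨p.bypass, p.bypass_isPath, (walkLength_bypass_le p).trans ?_⟩
  have h1 : 490 * nearMax (X u - X v) (Y u - Y v) ≤ 491 * (k * dist u v) :=
    nearMax_le (by positivity) (by rw [dist_comm, hd])
  have h2 : walkLength p ≤ 491 * dist u v := le_of_mul_le_mul_left (by linarith) hk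
  -- This suffices because `8 * (29 + 23 * 1.41) = 491.44`.
  have h3 : (7 / 5 : ℝ) + 1 / 100 ≤ √2 := Real.le_sqrt_of_sq_le (by norm_num)
  have h4 : 491 * dist u v ≤ t * dist u v := by
    gcongr
    linarith
  exact h2.trans h4
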